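/- \textbf{Setting.} An instance of generalized min sum set cover (GMSSC) consists of a finite vertex set $V$ and a finite family $E$ of hyperedges $e\subseteq V$ (repetitions allowed) with integer covering requirements $1\le k_e\le |e|$. It is an instance of min sum set cover (MSSC) if all $k_e=1$ and the hyperedges cover $V$. A (non-preemptive) schedule is an assignment of $V$ bijectively to the time slots $1,\dots,|V|$; the cover time of $e$ is the earliest $t$ such that at least $k_e$ vertices of $e$ are in slots $1,\dots,t$. A preemptive schedule consists of integrable functions $x_v\ge 0$ ($v\in V$) on $(0,\infty)$ with $\sum_v x_v(t)=1$ for all $t\in(0,|V|]$ and $\int_0^\infty x_v(t)\,dt=1$ for all $v$; the cover time of $e$ is the first $t\ge 0$ with $\int_0^t\sum_{v\in e}x_v(s)\,ds=k_e$. In both cases the cost of the schedule is the sum of the cover times of all hyperedges. Call $\rho\in\mathbb R$ a rounding factor (for MSSC) if for every GMSSC (respectively MSSC) instance and every preemptive schedule $x$ there is a non-preemptive schedule of cost at most $\rho\cdot\mathrm{cost}(x)$. The conjecture of Im, Sviridenko and van der Zwaan says that $2$ is a rounding factor. For $c_0,\delta>0$ and $r\in\mathbb N$ call a hypergraph with nonempty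 finite vertex set $V$ and nonempty finite edge family $E$ \emph{$(c_0,\delta,r)$-hard} if every edge has exactly $|V|/r$ vertices, all vertices have the same degree, and any set of $c\le c_0r$ vertices meets at most a $1-(1-1/r)^c+\delta$ fraction of the edges. For $k\in\mathbb N$, the Feige--Lov\'asz--Tetali instance $I_k(H)$ of a hypergraph $H$ is the disjoint union of $k$ copies of $H$, where each edge of the $i$-th copy ($1\le i\le k$) is repeated $a/i^2$ times, $a=(k!)^2$, and all requirements are $1$. \textbf{Theorem.} \begin{enumerate} \item For all $c_0,\delta>0$ and all sufficiently large $r$ there is a $(c_0,\delta,r)$-hard hypergraph without repeated edges. \item For every $\varepsilon>0$ and every sufficiently large $k$ there are $c_0,\delta>0$ and $R$ such that for every $r\ge R$ and every $(c_0,\delta,r)$-hard hypergraph $H$ with $m$ edges, $I_k(H)$ is an MSSC instance, it has a preemptive schedule $x$ with $|\mathrm{cost}(x)-mar\ln k|\le\varepsilon\, mar\ln k$, and each of its non-preemptive schedules has cost at least $(4-\varepsilon)\,mar\ln k$. \item Consequently every rounding factor for MSSC is at least $4$. \item In particular the conjecture of Im, Sviridenko and van der Zwaan is false. \item The approach that loses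 a factor $2$ from a linear program to a preemptive schedule, and then a rounding factor $\rho$ for MSSC, has guarantee $2\rho\ge 8$, even for MSSC. \end{enumerate} -/

import Mathlib

open MeasureTheory

/-- An instance of generalized min sum set cover on the vertex set `V`: a family of hyperedges
(repetitions allowed) indexed by `E`, each with a covering requirement `1 ≤ k_e ≤ |e|`. -/
structure GMSSC (V E : Type) where
  edge : E → Finset V
  req : E → ℕ
  req_pos : ∀ e, 1 ≤ req e
  req_le : ∀ e, req e ≤ (edge e).card

namespace GMSSC

variable {V E : Type}

/-- Min sum set cover: all requirements are `1`, and the sets cover the ground set. -/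
def IsMSSC (I : GMSSC V E) : Prop :=
  (∀ e, I.req e = 1) ∧ ∀ v, ∃ e, v ∈ I.edge e

/-- A non-preemptive schedule: an assignment of the vertices to the time slots `1, …, |V|`;
the vertex `v` occupies the slot `σ v + 1`, that is, the time interval `(σ v, σ v + 1]`. -/
abbrev Schedule (V : Type) [Fintype V] : Type := V ≃ Fin (Fintype.card V)

/-- The earliest time `t` by which `k_e` vertices of `e` have appeared in the ordering. -/
noncomputable def coverTime [Fintype V] (I : GMSSC V E) (σ : Schedule V) (e : E) : ℕ :=
  sInf {t : ℕ | I.req e ≤ ((I.edge e).filter fun v => (σ v : ℕ) + 1 ≤ t).card}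

/-- The total cover time of a non-preemptive schedule. -/
noncomputable def cost [Fintype V] [Fintype E] (I : GMSSC V E) (σ : Schedule V) : ℝ :=
  ∑ e, (I.coverTime σ e : ℝ)

/-- A preemptive schedule: rates `x v t ≥ 0` such that at each time of the horizon `(0, |V|]` the
machine is fully used, and every vertex is scheduled to a total extent of `1`. -/
structure IsPreemptive [Fintype V] (x : V → ℝ → ℝ) : Prop where
  nonneg : ∀ v t, 0 < t → 0 ≤ x v t
  integrable : ∀ v, IntegrableOn (x v) (Set.Ioi 0)
  sum_eq_one : ∀ t ∈ Set.Ioc (0 : ℝ) (Fintype.card V), ∑ v, x v t = 1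
  integral_eq_one : ∀ v, ∫ t in Set.Ioi (0 : ℝ), x v t = 1

/-- The (first) time `t` with `∫₀ᵗ ∑_{v ∈ e} x_v = k_e`. -/
noncomputable def preemptiveCoverTime (I : GMSSC V E) (x : V → ℝ → ℝ) (e : E) : ℝ :=
  sInf {t : ℝ | 0 ≤ t ∧ ∫ s in (0 : ℝ)..t, ∑ v ∈ I.edge e, x v s = I.req e}

/-- The total cover time of a preemptive schedule. -/
noncomputable def preemptiveCost [Fintype E] (I : GMSSC V E) (x : V → ℝ → ℝ) : ℝ :=
  ∑ e, I.preemptiveCoverTime x e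

end GMSSC

/-- Every preemptive schedule of every GMSSC instance can be rounded to a non-preemptive one
losing at most a factor `ρ`. -/
def IsRoundingFactor (ρ : ℝ) : Prop :=
  ∀ (V E : Type) [Fintype V] [Fintype E] (I : GMSSC V E) (x : V → ℝ → ℝ),
    GMSSC.IsPreemptive x → ∃ σ : GMSSC.Schedule V, I.cost σ ≤ ρ * I.preemptiveCost x

/-- The same for MSSC instances only. -/
def IsMSSCRoundingFactor (ρ : ℝ) : Prop :=
  ∀ (V E : Type) [Fintype V] [Fintype E] (I : GMSSC V E), I.IsMSSC → ∀ x : V → ℝ → ℝ,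
    GMSSC.IsPreemptive x → ∃ σ : GMSSC.Schedule V, I.cost σ ≤ ρ * I.preemptiveCost x

/-- The conjecture of Im, Sviridenko and van der Zwaan. -/
def ISVConjecture : Prop := IsRoundingFactor 2

/-- `α` is a guarantee for MSSC of the two-step approach: a factor `2` is lost from the LP to a
preemptive schedule, and then a factor `ρ`, valid for all preemptive schedules of MSSC instances,
from the preemptive to a non-preemptive schedule. -/
def IsTwoStepGuarantee (α : ℝ) : Prop :=
  ∃ ρ : ℝ, IsMSSCRoundingFactor ρ ∧ α = 2 * ρ

/-- A non-trivial uniform regular hypergraph all of whose edges have `|V| / r` vertices and in which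
any `c ≤ c₀ r` vertices cover at most a `1 - (1 - 1/r)^c + δ` fraction of the edges. -/
structure IsHardHypergraph {V E : Type} [Fintype V] [Fintype E] [DecidableEq V]
    (c₀ δ : ℝ) (r : ℕ) (edge : E → Finset V) : Prop where
  vertices_nonempty : Nonempty V
  edges_nonempty : Nonempty E
  uniform : ∀ e, r * (edge e).card = Fintype.card V
  regular : ∃ d : ℕ, ∀ v, (Finset.univ.filter fun e => v ∈ edge e).card = d
  cover_le : ∀ S : Finset V, (S.card : ℝ) ≤ c₀ * r →
    ((Finset.univ.filter fun e => (S ∩ edge e).Nonempty).card : ℝ)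
      ≤ (1 - (1 - 1 / (r : ℝ)) ^ S.card + δ) * Fintype.card E

theorem IsHardHypergraph.edge_nonempty {V E : Type} [Fintype V] [Fintype E] [DecidableEq V]
    {c₀ δ : ℝ} {r : ℕ} {edge : E → Finset V} (h : IsHardHypergraph c₀ δ r edge) (e : E) :
    (edge e).Nonempty := by
  have := h.vertices_nonempty
  have h1 : 0 < Fintype.card V := Fintype.card_pos
  rw [← h.uniform e] at h1
  exact Finset.card_pos.mp (Nat.pos_of_mul_pos_left h1)

/-- The Feige–Lovász–Tetali instance: `k` disjoint copies of a hypergraph, where the `i`-th copy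
(`1 ≤ i ≤ k`, represented by `i - 1 : Fin k`) has each edge repeated `(k!)² / i²` times (an exact
division), with all covering requirements equal to `1`. -/
def fltInstance {V E : Type} (k : ℕ) (edge : E → Finset V) (hne : ∀ e, (edge e).Nonempty) :
    GMSSC (Fin k × V) (Σ i : Fin k, E × Fin ((k.factorial) ^ 2 / ((i : ℕ) + 1) ^ 2)) where
  edge p := {p.1} ×ˢ edge p.2.1
  req _ := 1
  req_pos _ := le_rfl
  req_le p := by
    rw [Finset.card_product, Finset.card_singleton, one_mul]
    exact Finset.card_pos.mpr (hne p.2.1)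

open Filter Topology

/-! A preemptive machine can spread itself uniformly over one copy of the hypergraph, covering all
edges of that copy after `r` units of time. Treating the copies in turn costs `m a ∑ (1/i²) · i r ≈
m a r ln k` (`preemptiveCost_sequentialSchedule`). A non-preemptive schedule has diminishing
returns: `c` vertices of a hard hypergraph leave a fraction of about `exp (-c/r)` of the edges
uncovered. Its cost is the sum, over time, of the weight still uncovered. After `2 s r` slots this
weight is at least about `m a` times the minimum of `∑ exp (-yᵢ)/i²` under `∑ yᵢ = 2 s`. The optimum
`yᵢ = 2 ln (s/i)` for `i ≤ s` levels `s` terms at `1/s²` and leaves the tail `∑_{i>s} 1/i² ≈ 1/s`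
untouched, so the minimum is about `2/s` (`le_sum_exp_neg_div_sq`). Stages are `2 r` slots apart, so
the cost is at least about `m a · 2 r ∑_{s ≤ k} 2/s ≈ 4 m a r ln k` (`exists_le_cost_fltInstance`).
Complete uniform hypergraphs are hard, since avoiding `c` vertices becomes `c` independent events in
the limit (`exists_isHardHypergraph`). The ratio 4 then gives every negative statement. -/

/-! ### Calculus: the optimal effort and logarithmic sums -/

theorem sum_range_log_succ_le (s : ℕ) :
    ∑ i ∈ Finset.range (s + 1), Real.log ((i : ℝ) + 1)
      ≤ 1 + Real.log (s + 1) + (s + 1) * Real.log (s + 1) - (s + 1) := by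
  induction s with
  | zero => simp
  | succ s ih =>
    rw [Finset.sum_range_succ]
    -- The inductive step of this one-sided Stirling bound amounts to `(s+2) (log (s+2) - log (s+1))
    -- ≥ 1`.
    have h1 : 1 / ((s : ℝ) + 2) ≤ Real.log (s + 2) - Real.log (s + 1) := by
      have h := Real.one_sub_inv_le_log_of_pos (x := ((s : ℝ) + 2) / (s + 1)) (by positivity)
      rw [Real.log_div (by positivity) (by positivity)] at h
      refine le_trans (le_of_eq ?_) h
      field_simp
      ring
    rw [div_le_iff₀ (by positivity)] at h1
    have e : ((s : ℝ) + 1 + 1) = s + 2 := by ring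
    push_cast
    rw [e]
    linarith

theorem one_div_sub_one_div_le_sum_Ico {s k : ℕ} (h : s ≤ k) :
    1 / ((s : ℝ) + 1) - 1 / ((k : ℝ) + 1) ≤ ∑ i ∈ Finset.Ico s k, 1 / ((i : ℝ) + 1) ^ 2 := by
  induction k, h using Nat.le_induction with
  | base => simp
  | succ k hk ih =>
    rw [Finset.sum_Ico_succ_top hk]
    have : 1 / ((k : ℝ) + 1) - 1 / ((k : ℝ) + 1 + 1) ≤ 1 / ((k : ℝ) + 1) ^ 2 := by
      rw [div_sub_div _ _ (by positivity) (by positivity), div_le_div_iff₀ (by positivity) (by positivity)]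
      have : (0 : ℝ) ≤ k := by positivity
      nlinarith [mul_nonneg this this]
    push_cast
    linarith

/-- Lagrangian bound for the cheapest distribution of total effort `2 s` over the copies. -/
theorem le_sum_exp_neg_div_sq {s k : ℕ} (hs : 1 ≤ s) (hk : s ≤ k) (y : ℕ → ℝ) (hy : ∀ i, 0 ≤ y i)
    (hsum : ∑ i ∈ Finset.range k, y i ≤ 2 * s) :
    1 / (s : ℝ) + 1 / ((s : ℝ) + 1) - 1 / ((k : ℝ) + 1) - (2 + 2 * Real.log s) / (s : ℝ) ^ 2
      ≤ ∑ i ∈ Finset.range k, 1 / ((i : ℝ) + 1) ^ 2 * Real.exp (-y i) := by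
  have hs0 : (0 : ℝ) < s := by exact_mod_cast hs
  -- Tangent line at the optimal effort `2 log (s/(i+1))`, where value and negated slope are both
  -- `1/s²`, the common Lagrange multiplier.
  have A : ∀ i ∈ Finset.range s,
      (1 + 2 * (Real.log s - Real.log ((i : ℝ) + 1))) / (s : ℝ) ^ 2 - y i / (s : ℝ) ^ 2
        ≤ 1 / ((i : ℝ) + 1) ^ 2 * Real.exp (-y i) := by
    intro i _
    have hi : (0 : ℝ) < (i : ℝ) + 1 := by positivity
    set u := 2 * (Real.log s - Real.log ((i : ℝ) + 1)) with hu
    have h1 : Real.exp u = (s : ℝ) ^ 2 / ((i : ℝ) + 1) ^ 2 := by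
      rw [hu, mul_comm, Real.exp_mul, Real.exp_sub, Real.exp_log hs0, Real.exp_log hi]
      rw [Real.rpow_two, div_pow]
    have h2 := Real.add_one_le_exp (u - y i)
    have h3 : Real.exp (u - y i) = (s : ℝ) ^ 2 * (1 / ((i : ℝ) + 1) ^ 2 * Real.exp (-y i)) := by
      rw [sub_eq_add_neg, Real.exp_add, h1]; ring
    rw [← sub_div, div_le_iff₀ (by positivity)]
    linarith
  -- Here the optimal effort is `0`, and the slope there is at most `1/s²` in absolute value.
  have B : ∀ i ∈ Finset.Ico s k,
      1 / ((i : ℝ) + 1) ^ 2 - y i / (s : ℝ) ^ 2 ≤ 1 / ((i : ℝ) + 1) ^ 2 * Real.exp (-y i) := by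
    intro i hi
    have h1 : (s : ℝ) ≤ (i : ℝ) + 1 := by
      have : (s : ℝ) ≤ i := by exact_mod_cast (Finset.mem_Ico.mp hi).1
      linarith
    have h2 : 1 / ((i : ℝ) + 1) ^ 2 ≤ 1 / (s : ℝ) ^ 2 := by gcongr
    have h3 := Real.add_one_le_exp (-y i)
    have h4 : 1 / ((i : ℝ) + 1) ^ 2 * (-y i + 1) ≤ 1 / ((i : ℝ) + 1) ^ 2 * Real.exp (-y i) := by
      gcongr
    have h5 := mul_le_mul_of_nonneg_right h2 (hy i)
    have : y i / (s : ℝ) ^ 2 = 1 / (s : ℝ) ^ 2 * y i := by ring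
    linarith
  have A' := Finset.sum_le_sum A
  have B' := Finset.sum_le_sum B
  rw [Finset.sum_sub_distrib, ← Finset.sum_div, ← Finset.sum_div] at A'
  rw [Finset.sum_sub_distrib, ← Finset.sum_div] at B'
  have C := one_div_sub_one_div_le_sum_Ico hk
  -- By Stirling the optimal efforts add up to `2 s` up to a logarithmic error, which cancels the
  -- budget.
  have D : 2 * (s - 1 - Real.log s) + s
      ≤ ∑ i ∈ Finset.range s, (1 + 2 * (Real.log s - Real.log ((i : ℝ) + 1))) := by
    rw [Finset.sum_add_distrib, ← Finset.mul_sum, Finset.sum_sub_distrib]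
    obtain ⟨s, rfl⟩ : ∃ s', s = s' + 1 := ⟨s - 1, by omega⟩
    have := sum_range_log_succ_le s
    simp only [Finset.sum_const, Finset.card_range, nsmul_eq_mul]
    push_cast
    linarith
  have D' := div_le_div_of_nonneg_right D (by positivity : (0 : ℝ) ≤ (s : ℝ) ^ 2)
  have F := div_le_div_of_nonneg_right hsum (by positivity : (0 : ℝ) ≤ (s : ℝ) ^ 2)
  rw [← Finset.sum_range_add_sum_Ico _ hk, add_div] at F
  rw [← Finset.sum_range_add_sum_Ico _ hk]
  have G : (2 * (s - 1 - Real.log s) + s) / (s : ℝ) ^ 2 - 2 * s / (s : ℝ) ^ 2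
      = 1 / (s : ℝ) - (2 + 2 * Real.log s) / (s : ℝ) ^ 2 := by
    field_simp
    ring
  linarith

/-- Cut time into `k` blocks of length `N` and bound each block by its own `b s`. -/
theorem sum_range_le_sum_range_mul {N k : ℕ} {b g : ℕ → ℝ}
    (h : ∀ s < k, ∀ t < N * (s + 1), b s ≤ g t) :
    N * ∑ s ∈ Finset.range k, b s ≤ ∑ t ∈ Finset.range (N * k), g t := by
  induction k with
  | zero => simp
  | succ k ih =>
    rw [Finset.sum_range_succ, mul_add, Nat.mul_succ, Finset.sum_range_add]
    refine add_le_add (ih fun s hs => h s (by omega)) ?_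
    have := Finset.card_nsmul_le_sum (Finset.range N) (fun x => g (N * k + x)) (b k) (by
      intro x hx
      refine h k (by omega) _ ?_
      have := Finset.mem_range.mp hx
      rw [Nat.mul_succ]; omega)
    simpa using this

/-- Since `1 - 1/r = 1/(1 + 1/(r-1))`, this is `1 + x ≤ exp x`; using `r - 1` avoids any error term.
-/
theorem exp_neg_div_le_one_sub_pow {r : ℕ} (hr : 2 ≤ r) (c : ℕ) :
    Real.exp (-((c : ℝ) / ((r : ℝ) - 1))) ≤ (1 - 1 / (r : ℝ)) ^ c := by
  have h2 : (2 : ℝ) ≤ r := by exact_mod_cast hr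
  have e : -((c : ℝ) / ((r : ℝ) - 1)) = c * (-(1 / ((r : ℝ) - 1))) := by ring
  rw [e, Real.exp_nat_mul]
  refine pow_le_pow_left₀ (Real.exp_pos _).le ?_ c
  have h3 := Real.add_one_le_exp (1 / ((r : ℝ) - 1))
  rw [Real.exp_neg]
  have h5 : 0 < (r : ℝ) - 1 := by linarith
  have h4 : (1 - 1 / (r : ℝ)) = (1 / ((r : ℝ) - 1) + 1)⁻¹ := by
    rw [div_add_one h5.ne', inv_div, add_sub_cancel, sub_div, div_self (by linarith)]
  rw [h4]
  gcongr

theorem summable_one_add_log_div_sq :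
    Summable fun s : ℕ => (2 + 2 * Real.log ((s : ℝ) + 1)) / ((s : ℝ) + 1) ^ 2 := by
  -- From `2 + 2 log x ≤ 2 + 4 √x ≤ 6 √x` for `x ≥ 1`.
  have h : Summable fun s : ℕ => 6 * (1 / ((s + 1 : ℕ) : ℝ) ^ (3 / 2 : ℝ)) :=
    ((summable_nat_add_iff 1).mpr
      (Real.summable_one_div_nat_rpow.mpr (by norm_num : (1 : ℝ) < 3 / 2))).mul_left 6
  refine Summable.of_nonneg_of_le (fun s => ?_) (fun s => ?_) h
  · have : 0 ≤ Real.log ((s : ℝ) + 1) := Real.log_nonneg (by linarith [s.cast_nonneg (α := ℝ)])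
    positivity
  · have hs : (1 : ℝ) ≤ (s : ℝ) + 1 := by linarith [s.cast_nonneg (α := ℝ)]
    have h1 := Real.log_le_rpow_div (x := (s : ℝ) + 1) (by linarith) (ε := 1 / 2) (by norm_num)
    have h2 : (1 : ℝ) ≤ ((s : ℝ) + 1) ^ (1 / 2 : ℝ) := Real.one_le_rpow hs (by norm_num)
    have h3 : ((s : ℝ) + 1) ^ 2
        = ((s : ℝ) + 1) ^ (3 / 2 : ℝ) * ((s : ℝ) + 1) ^ (1 / 2 : ℝ) := by
      rw [← Real.rpow_add (by linarith)]
      norm_num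
    have h4 : 0 < ((s : ℝ) + 1) ^ (3 / 2 : ℝ) := Real.rpow_pos_of_pos (by linarith) _
    push_cast
    rw [h3, div_le_iff₀ (by positivity)]
    have : 6 * (1 / ((s : ℝ) + 1) ^ (3 / 2 : ℝ)) *
        (((s : ℝ) + 1) ^ (3 / 2 : ℝ) * ((s : ℝ) + 1) ^ (1 / 2 : ℝ))
        = 6 * ((s : ℝ) + 1) ^ (1 / 2 : ℝ) := by field_simp
    rw [this]
    linarith

theorem log_le_sum_range_one_div (k : ℕ) :
    Real.log ((k : ℝ) + 1) ≤ ∑ i ∈ Finset.range k, 1 / ((i : ℝ) + 1) := by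
  have := log_add_one_le_harmonic k
  simpa [harmonic] using this

theorem sum_range_one_div_le (k : ℕ) :
    ∑ i ∈ Finset.range k, 1 / ((i : ℝ) + 1) ≤ 1 + Real.log k := by
  have := harmonic_le_one_add_log k
  simpa [harmonic] using this

/-- The effort bounds of `le_sum_exp_neg_div_sq`, summed over all stages. -/
theorem exists_log_sub_le_sum :
    ∃ C : ℝ, 0 ≤ C ∧ ∀ k : ℕ, 1 ≤ k → 2 * Real.log k - C ≤ ∑ s ∈ Finset.range k,
      (1 / ((s : ℝ) + 1) + 1 / ((s : ℝ) + 1 + 1) - 1 / ((k : ℝ) + 1)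
        - (2 + 2 * Real.log ((s : ℝ) + 1)) / ((s : ℝ) + 1) ^ 2) := by
  have nn : ∀ s : ℕ, 0 ≤ (2 + 2 * Real.log ((s : ℝ) + 1)) / ((s : ℝ) + 1) ^ 2 := fun s => by
    have : 0 ≤ Real.log ((s : ℝ) + 1) := Real.log_nonneg (by linarith [s.cast_nonneg (α := ℝ)])
    positivity
  -- The `2` pays for the `k` terms `1/(k+1)` and for the first term missing from the shifted
  -- harmonic sum.
  refine ⟨2 + ∑' s : ℕ, (2 + 2 * Real.log ((s : ℝ) + 1)) / ((s : ℝ) + 1) ^ 2,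
    add_nonneg (by norm_num) (tsum_nonneg nn), fun k hk => ?_⟩
  have hk0 : (0 : ℝ) < k := by exact_mod_cast hk
  rw [Finset.sum_sub_distrib, Finset.sum_sub_distrib, Finset.sum_add_distrib]
  have h1 := summable_one_add_log_div_sq.sum_le_tsum (Finset.range k) fun s _ => nn s
  have h2 := log_le_sum_range_one_div k
  have h3 : Real.log k ≤ Real.log ((k : ℝ) + 1) := Real.log_le_log hk0 (by linarith)
  have h4 : ∑ s ∈ Finset.range k, 1 / ((k : ℝ) + 1) ≤ 1 := by
    rw [Finset.sum_const, Finset.card_range, nsmul_eq_mul, mul_one_div, div_le_one (by positivity)]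
    linarith
  have h5 : ∑ i ∈ Finset.range k, 1 / ((i : ℝ) + 1) - 1
      ≤ ∑ i ∈ Finset.range k, 1 / ((i : ℝ) + 1 + 1) := by
    have := Finset.sum_range_succ (fun i : ℕ => 1 / ((i : ℝ) + 1)) k
    rw [Finset.sum_range_succ'] at this
    push_cast at this
    have h : 0 ≤ 1 / ((k : ℝ) + 1) := by positivity
    rw [zero_add, div_one] at this
    linarith
  linarith

/-! ### Hardness of complete uniform hypergraphs -/

/-- Raising `c` by one multiplies the ratio by `(r s - c - s)/(r s - c)`, which tends to `1 - 1/r`.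
-/
theorem tendsto_choose_sub_div_choose {r : ℕ} (hr : 2 ≤ r) (c : ℕ) :
    Tendsto (fun s : ℕ => ((r * s - c).choose s : ℝ) / ((r * s).choose s : ℝ)) atTop
      (𝓝 ((1 - 1 / (r : ℝ)) ^ c)) := by
  have hr0 : (2 : ℝ) ≤ r := by exact_mod_cast hr
  induction c with
  | zero =>
    refine tendsto_const_nhds.congr fun s => ?_
    have : ((r * s).choose s : ℝ) ≠ 0 :=
      Nat.cast_ne_zero.mpr (Nat.choose_pos (Nat.le_mul_of_pos_left s (by omega))).ne'
    simp [div_self this]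
  | succ c ih =>
    have hc : Tendsto (fun s : ℕ => (c : ℝ) / s) atTop (𝓝 0) := tendsto_const_div_atTop_nhds_zero_nat _
    have key : Tendsto (fun s : ℕ => ((r : ℝ) - c / s - 1) / (r - c / s)) atTop
        (𝓝 (1 - 1 / (r : ℝ))) := by
      have := ((tendsto_const_nhds (x := (r : ℝ))).sub hc |>.sub_const 1).div
        ((tendsto_const_nhds (x := (r : ℝ))).sub hc) (by simp; omega)
      rw [sub_zero, sub_div, div_self (by linarith)] at this
      exact this
    rw [pow_succ]
    refine (ih.mul key).congr' ?_
    filter_upwards [eventually_ge_atTop (c + 1)] with s hs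
    have hN : c + s + 1 ≤ r * s := by nlinarith
    obtain ⟨N, hN'⟩ : ∃ N, r * s = c + 1 + N := ⟨r * s - (c + 1), by omega⟩
    have h1 := Nat.choose_mul_succ_eq N s
    have h2 : (N.choose s : ℝ) * (N + 1) = ((N + 1).choose s : ℝ) * (N + 1 - s) := by
      have : ((N + 1 - s : ℕ) : ℝ) = N + 1 - s := by
        rw [Nat.cast_sub (by omega)]; push_cast; ring
      rw [← this]; exact_mod_cast h1
    have e1 : r * s - (c + 1) = N := by omega
    have e2 : r * s - c = N + 1 := by omega
    have e3 : (r : ℝ) * s = c + 1 + N := by exact_mod_cast hN'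
    have hs0 : (0 : ℝ) < s := by exact_mod_cast (by omega : 0 < s)
    rw [e1, e2]
    have e4 : ((r : ℝ) - c / s - 1) / (r - c / s) = (N + 1 - s) / (N + 1) := by
      have a1 : (r : ℝ) - c / s - 1 = (N + 1 - s) / s := by
        rw [eq_div_iff hs0.ne']; field_simp; linarith
      have a2 : (r : ℝ) - c / s = (N + 1) / s := by
        rw [eq_div_iff hs0.ne']; field_simp; linarith
      rw [a1, a2, div_div_div_cancel_right₀ hs0.ne']
    rw [e4, div_mul_div_comm, ← h2, mul_div_mul_right _ _ (by positivity)]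

theorem card_filter_inter_nonempty_powersetCard {V : Type} [Fintype V] [DecidableEq V]
    (s : ℕ) (S : Finset V) :
    ((Finset.univ.powersetCard s).filter fun e => (S ∩ e).Nonempty).card
        + (Fintype.card V - S.card).choose s
      = (Fintype.card V).choose s := by
  have h := Finset.card_filter_add_card_filter_not (s := Finset.univ.powersetCard s)
    (fun e : Finset V => (S ∩ e).Nonempty)
  have h2 : ((Finset.univ.powersetCard s).filter fun e : Finset V => ¬ (S ∩ e).Nonempty)
      = Sᶜ.powersetCard s := by
    ext e
    simp only [Finset.mem_filter, Finset.mem_powersetCard, Finset.not_nonempty_iff_eq_empty,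
      Finset.subset_univ, true_and, ← Finset.disjoint_iff_inter_eq_empty,
      Finset.subset_compl_iff_disjoint_left]
    tauto
  rw [h2, Finset.card_powersetCard, Finset.card_powersetCard, Finset.card_compl,
    Finset.card_univ] at h
  exact h

theorem card_filter_mem_powersetCard {V : Type} [Fintype V] [DecidableEq V]
    (s : ℕ) (v : V) :
    ((Finset.univ.powersetCard s).filter fun e => v ∈ e).card
      = (Fintype.card V).choose s - (Fintype.card V - 1).choose s := by
  have h := card_filter_inter_nonempty_powersetCard s {v}
  have h2 : ((Finset.univ.powersetCard s).filter fun e : Finset V => ({v} ∩ e).Nonempty)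
      = (Finset.univ.powersetCard s).filter fun e => v ∈ e := by
    refine Finset.filter_congr fun e _ => ?_
    rw [← Finset.not_disjoint_iff_nonempty_inter, Finset.disjoint_singleton_left, not_not]
  rw [h2, Finset.card_singleton] at h
  omega

/-- Complete uniform hypergraphs on sufficiently many vertices are hard. -/
theorem exists_isHardHypergraph (c₀ δ : ℝ) (hδ : 0 < δ) {r : ℕ} (hr : 2 ≤ r) :
    ∃ (n m : ℕ) (edge : Fin m → Finset (Fin n)),
      Function.Injective edge ∧ IsHardHypergraph c₀ δ r edge := by
  -- Only finitely many `c` matter, so one `s` serves them all.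
  have h1 : ∀ᶠ s : ℕ in atTop, ∀ c ∈ Set.Iic ⌊c₀ * r⌋₊,
      (1 - 1 / (r : ℝ)) ^ c - δ < ((r * s - c).choose s : ℝ) / ((r * s).choose s : ℝ) :=
    (Set.finite_Iic _).eventually_all.mpr fun c _ =>
      (tendsto_choose_sub_div_choose hr c).eventually (lt_mem_nhds (by linarith))
  obtain ⟨s, hs, hs1⟩ := (h1.and (eventually_ge_atTop 1)).exists
  have hpos : 0 < (r * s).choose s := Nat.choose_pos (Nat.le_mul_of_pos_left s (by omega))
  set P := (Finset.univ : Finset (Fin (r * s))).powersetCard s with hP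
  have hPc : P.card = (r * s).choose s := by simp [hP]
  let f : Fin P.card ≃ P := P.equivFin.symm
  have cnt : ∀ p : Finset (Fin (r * s)) → Prop, [DecidablePred p] →
      (Finset.univ.filter fun i => p (f i : Finset (Fin (r * s)))).card = (P.filter p).card := by
    intro p _
    refine Finset.card_bij (fun i _ => (f i : Finset (Fin (r * s)))) ?_ ?_ ?_
    · intro i hi
      exact Finset.mem_filter.mpr ⟨(f i).2, (Finset.mem_filter.mp hi).2⟩
    · intro i _ j _ hij
      exact f.injective (Subtype.ext hij)
    · intro e he
      have he' := Finset.mem_filter.mp he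
      exact ⟨f.symm ⟨e, he'.1⟩, by simpa using he'.2, by simp⟩
  refine ⟨r * s, P.card, fun i => f i, Subtype.val_injective.comp f.injective, ?_⟩
  refine ⟨?_, ?_, ?_, ?_, ?_⟩
  · exact ⟨⟨0, by positivity⟩⟩
  · exact ⟨⟨0, by omega⟩⟩
  · intro i
    rw [(Finset.mem_powersetCard.mp (f i).2).2, Fintype.card_fin]
  · exact ⟨_, fun v => (cnt fun e => v ∈ e).trans (card_filter_mem_powersetCard s v)⟩
  · intro S hS
    have h2 := hs S.card (Nat.le_floor hS)
    have h3 := card_filter_inter_nonempty_powersetCard s S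
    rw [Fintype.card_fin] at h3
    rw [cnt fun e => (S ∩ e).Nonempty, Fintype.card_fin, hPc]
    have h4 : ((P.filter fun e => (S ∩ e).Nonempty).card : ℝ) + ((r * s - S.card).choose s : ℝ)
        = ((r * s).choose s : ℝ) := by exact_mod_cast h3
    rw [lt_div_iff₀ (by exact_mod_cast hpos)] at h2
    linarith

/-! ### Lower bound for non-preemptive schedules -/

namespace GMSSC

/-- In a schedule, an edge of requirement `1` is covered no earlier than the number of times at
which it has not yet been met. -/
theorem card_le_coverTime {V E : Type} [Fintype V] (I : GMSSC V E) (σ : Schedule V) (e : E)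
    (hreq : I.req e = 1) (T : Finset ℕ) (hT : ∀ t ∈ T, ∀ v ∈ I.edge e, t ≤ (σ v : ℕ)) :
    T.card ≤ I.coverTime σ e := by
  -- The infimum is attained: by time `|V|` everything has appeared, so the default `sInf ∅ = 0`
  -- does not occur.
  have hmem : I.coverTime σ e ∈
      {t : ℕ | I.req e ≤ ((I.edge e).filter fun v => (σ v : ℕ) + 1 ≤ t).card} := by
    refine Nat.sInf_mem ⟨Fintype.card V, ?_⟩
    have : ((I.edge e).filter fun v => (σ v : ℕ) + 1 ≤ Fintype.card V) = I.edge e :=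
      Finset.filter_true_of_mem fun v _ => (σ v).2
    rw [Set.mem_ofPred_eq, this]
    exact I.req_le e
  rw [Set.mem_ofPred_eq, hreq] at hmem
  obtain ⟨v, hv⟩ := Finset.card_pos.mp hmem
  rw [Finset.mem_filter] at hv
  calc T.card ≤ (Finset.range (I.coverTime σ e)).card := Finset.card_le_card fun t ht => by
        have := hT t ht v hv.1
        exact Finset.mem_range.mpr (by omega)
    _ = _ := Finset.card_range _

end GMSSC

namespace IsHardHypergraph

theorem pos {V E : Type} [Fintype V] [Fintype E] [DecidableEq V]
    {c₀ δ : ℝ} {r : ℕ} {edge : E → Finset V}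
    (h : IsHardHypergraph c₀ δ r edge) : 0 < r := by
  have := h.vertices_nonempty
  obtain ⟨e⟩ := h.edges_nonempty
  refine Nat.pos_of_ne_zero fun h0 => ?_
  have h1 := h.uniform e
  rw [h0, zero_mul] at h1
  exact Fintype.card_ne_zero h1.symm

theorem le_card {V E : Type} [Fintype V] [Fintype E] [DecidableEq V]
    {c₀ δ : ℝ} {r : ℕ} {edge : E → Finset V}
    (h : IsHardHypergraph c₀ δ r edge) : r ≤ Fintype.card V := by
  obtain ⟨e⟩ := h.edges_nonempty
  rw [← h.uniform e]
  exact Nat.le_mul_of_pos_right r (Finset.card_pos.mpr (h.edge_nonempty e))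

theorem exists_mem {V E : Type} [Fintype V] [Fintype E] [DecidableEq V]
    {c₀ δ : ℝ} {r : ℕ} {edge : E → Finset V}
    (h : IsHardHypergraph c₀ δ r edge) (v : V) : ∃ e, v ∈ edge e := by
  obtain ⟨d, hd⟩ := h.regular
  obtain ⟨e⟩ := h.edges_nonempty
  obtain ⟨w, hw⟩ := h.edge_nonempty e
  have h1 : 0 < d := by
    rw [← hd w]
    exact Finset.card_pos.mpr ⟨e, by simpa using hw⟩
  rw [← hd v] at h1
  obtain ⟨e', he'⟩ := Finset.card_pos.mp h1
  exact ⟨e', by simpa using he'⟩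

theorem le_card_filter_disjoint {V E : Type} [Fintype V] [Fintype E] [DecidableEq V]
    {c₀ δ : ℝ} {r : ℕ} {edge : E → Finset V}
    (h : IsHardHypergraph c₀ δ r edge) (S : Finset V)
    (hS : (S.card : ℝ) ≤ c₀ * r) :
    ((1 - 1 / (r : ℝ)) ^ S.card - δ) * Fintype.card E
      ≤ ((Finset.univ.filter fun e => ¬ (S ∩ edge e).Nonempty).card : ℝ) := by
  have h1 := h.cover_le S hS
  have h2 : ((Finset.univ.filter fun e => (S ∩ edge e).Nonempty).card : ℝ)
      + ((Finset.univ.filter fun e => ¬ (S ∩ edge e).Nonempty).card : ℝ) = Fintype.card E := by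
    exact_mod_cast Finset.card_filter_add_card_filter_not (s := (Finset.univ : Finset E))
      (fun e => (S ∩ edge e).Nonempty)
  linarith

end IsHardHypergraph

theorem cast_factorial_sq_div {k : ℕ} (i : Fin k) :
    ((k.factorial ^ 2 / ((i : ℕ) + 1) ^ 2 : ℕ) : ℝ)
      = (k.factorial : ℝ) ^ 2 * (1 / ((i : ℝ) + 1) ^ 2) := by
  rw [Nat.cast_div (pow_dvd_pow_of_dvd (Nat.dvd_factorial (by omega) i.2) 2)
    (by positivity)]
  push_cast
  ring

theorem isMSSC_fltInstance {V E : Type} [Fintype V] [Fintype E] [DecidableEq V]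
    {c₀ δ : ℝ} {r : ℕ} {edge : E → Finset V}
    (h : IsHardHypergraph c₀ δ r edge) (k : ℕ) :
    (fltInstance k edge h.edge_nonempty).IsMSSC := by
  refine ⟨fun _ => rfl, fun ⟨i, v⟩ => ?_⟩
  obtain ⟨e, he⟩ := h.exists_mem v
  have : 0 < k.factorial ^ 2 / ((i : ℕ) + 1) ^ 2 :=
    Nat.div_pos (Nat.pow_le_pow_left (Nat.le_of_dvd (Nat.factorial_pos k)
      (Nat.dvd_factorial (by omega) i.2)) 2) (by positivity)
  exact ⟨⟨i, e, ⟨0, this⟩⟩, by simpa [fltInstance] using he⟩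

/-- The vertices of the `i`-th copy that are scheduled up to time `t`. -/
def scheduledIn {V : Type} [Fintype V] {k : ℕ} (σ : GMSSC.Schedule (Fin k × V)) (i : Fin k) (t : ℕ) : Finset V :=
  Finset.univ.filter fun v => (σ (i, v) : ℕ) < t

theorem sum_card_scheduledIn_le {V : Type} [Fintype V] {k : ℕ}
    (σ : GMSSC.Schedule (Fin k × V)) (t : ℕ) :
    ∑ i, (scheduledIn σ i t).card ≤ t := by
  calc ∑ i, (scheduledIn σ i t).card
      = (Finset.univ.sigma fun i => scheduledIn σ i t).card := (Finset.card_sigma _ _).symm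
    _ ≤ (Finset.range t).card := by
        refine Finset.card_le_card_of_injOn (fun p => (σ (p.1, p.2) : ℕ)) ?_ ?_
        · intro p hp
          have := (Finset.mem_sigma.mp hp).2
          simpa [scheduledIn] using this
        · rintro ⟨i, v⟩ _ ⟨j, w⟩ _ hpq
          have := σ.injective (Fin.ext hpq)
          simp only [Prod.mk.injEq] at this
          obtain ⟨rfl, rfl⟩ := this
          rfl
    _ = t := Finset.card_range t

/-- Double counting of pairs of a time and an edge uncovered at that time; stopping at `M` only
lowers the sum. -/
theorem sum_card_uncovered_le_cost {V E : Type} [Fintype V] [Fintype E] [DecidableEq V]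
    {edge : E → Finset V} (hne : ∀ e, (edge e).Nonempty) {k : ℕ}
    (σ : GMSSC.Schedule (Fin k × V)) (M : ℕ) :
    ∑ t ∈ Finset.range M, ∑ i : Fin k, (k.factorial : ℝ) ^ 2 * (1 / ((i : ℝ) + 1) ^ 2) *
        ((Finset.univ.filter fun e => ¬ (scheduledIn σ i t ∩ edge e).Nonempty).card : ℝ)
      ≤ (fltInstance k edge hne).cost σ := by
  have h1 : ∀ p : Σ i : Fin k, E × Fin (k.factorial ^ 2 / ((i : ℕ) + 1) ^ 2),
      ∑ t ∈ Finset.range M, (if ¬ (scheduledIn σ p.1 t ∩ edge p.2.1).Nonempty then (1 : ℝ) else 0)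
        ≤ ((fltInstance k edge hne).coverTime σ p : ℝ) := by
    intro p
    rw [← Finset.sum_filter, Finset.sum_const, nsmul_eq_mul, mul_one]
    refine Nat.cast_le.mpr (GMSSC.card_le_coverTime (fltInstance k edge hne) σ p rfl _ ?_)
    intro t ht
    rw [Finset.mem_filter] at ht
    rintro ⟨j, v⟩ hv
    simp only [fltInstance, Finset.mem_product, Finset.mem_singleton] at hv
    obtain ⟨rfl, hv⟩ := hv
    by_contra hlt
    exact ht.2 ⟨v, Finset.mem_inter.mpr ⟨by simpa [scheduledIn] using hlt, hv⟩⟩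
  refine le_trans (le_of_eq ?_) (Finset.sum_le_sum fun p _ => h1 p)
  refine Eq.trans ?_ Finset.sum_comm
  refine Finset.sum_congr rfl fun t _ => ?_
  rw [Fintype.sum_sigma]
  refine Finset.sum_congr rfl fun i _ => ?_
  rw [Fintype.sum_prod_type, ← Finset.sum_boole (R := ℝ), Finset.mul_sum]
  refine Finset.sum_congr rfl fun e _ => ?_
  change _ = ∑ _y : Fin (k.factorial ^ 2 / ((i : ℕ) + 1) ^ 2),
    (if ¬ (scheduledIn σ i t ∩ edge e).Nonempty then (1 : ℝ) else 0)
  rw [Finset.sum_const, Finset.card_univ, Fintype.card_fin, nsmul_eq_mul, cast_factorial_sq_div]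

/-- The weighted number of uncovered edges while at most `2 s (r - 1)` slots are used. -/
theorem le_sum_card_uncovered {V E : Type} [Fintype V] [Fintype E] [DecidableEq V]
    {r k s t : ℕ} {edge : E → Finset V} (hr : 2 ≤ r) (hs : s < k)
    (h : IsHardHypergraph (2 * k) (1 / (k : ℝ) ^ 2) r edge)
    (σ : GMSSC.Schedule (Fin k × V)) (ht : t < 2 * (r - 1) * (s + 1)) :
    (k.factorial : ℝ) ^ 2 * Fintype.card E *
        ((1 / ((s : ℝ) + 1) + 1 / ((s : ℝ) + 1 + 1) - 1 / ((k : ℝ) + 1)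
          - (2 + 2 * Real.log ((s : ℝ) + 1)) / ((s : ℝ) + 1) ^ 2) - 1 / k)
      ≤ ∑ i : Fin k, (k.factorial : ℝ) ^ 2 * (1 / ((i : ℝ) + 1) ^ 2) *
        ((Finset.univ.filter fun e => ¬ (scheduledIn σ i t ∩ edge e).Nonempty).card : ℝ) := by
  have hr0 : (2 : ℝ) ≤ r := by exact_mod_cast hr
  have hk0 : (0 : ℝ) < k := by exact_mod_cast (by omega : 0 < k)
  have hrc : ((r - 1 : ℕ) : ℝ) = (r : ℝ) - 1 := by rw [Nat.cast_sub (by omega)]; simp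
  set c : Fin k → ℕ := fun i => (scheduledIn σ i t).card with hc
  have hct : ∑ i, c i ≤ t := sum_card_scheduledIn_le σ t
  have htR : (t : ℝ) ≤ 2 * ((r : ℝ) - 1) * ((s : ℝ) + 1) := by
    rw [← hrc]; exact_mod_cast ht.le
  have hsk : (s : ℝ) + 1 ≤ k := by exact_mod_cast hs
  -- This is why `c₀ = 2 k` suffices.
  have hcle : ∀ i, (c i : ℝ) ≤ 2 * k * r := by
    intro i
    have h1 : c i ≤ t := (Finset.single_le_sum (fun _ _ => Nat.zero_le _) (Finset.mem_univ i)).trans hct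
    have h2 : (c i : ℝ) ≤ t := by exact_mod_cast h1
    nlinarith
  set y : ℕ → ℝ := fun i => if hi : i < k then (c ⟨i, hi⟩ : ℝ) / ((r : ℝ) - 1) else 0 with hy
  have hyi : ∀ i : Fin k, y i = (c i : ℝ) / ((r : ℝ) - 1) := fun i => by simp [hy]
  have hy0 : ∀ i, 0 ≤ y i := by
    intro i
    simp only [hy]
    split_ifs
    · exact div_nonneg (Nat.cast_nonneg _) (by linarith)
    · exact le_rfl
  have hys : ∑ i ∈ Finset.range k, y i ≤ 2 * ((s + 1 : ℕ) : ℝ) := by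
    rw [← Fin.sum_univ_eq_sum_range, Finset.sum_congr rfl fun i _ => hyi i, ← Finset.sum_div,
      div_le_iff₀ (by linarith)]
    have : (∑ i, (c i : ℝ)) ≤ t := by exact_mod_cast hct
    push_cast
    linarith
  have key := le_sum_exp_neg_div_sq (Nat.succ_le_succ (Nat.zero_le s)) hs y hy0 hys
  rw [← Fin.sum_univ_eq_sum_range (fun i => 1 / ((i : ℝ) + 1) ^ 2 * Real.exp (-y i))] at key
  push_cast at key
  have term : ∀ i : Fin k, (k.factorial : ℝ) ^ 2 * Fintype.card E *
      (1 / ((i : ℝ) + 1) ^ 2 * Real.exp (-y i) - 1 / (k : ℝ) ^ 2)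
      ≤ (k.factorial : ℝ) ^ 2 * (1 / ((i : ℝ) + 1) ^ 2) *
        ((Finset.univ.filter fun e => ¬ (scheduledIn σ i t ∩ edge e).Nonempty).card : ℝ) := by
    intro i
    have h1 := h.le_card_filter_disjoint (scheduledIn σ i t) (hcle i)
    have h2 := exp_neg_div_le_one_sub_pow hr (c i)
    rw [← hyi] at h2
    have hw1 : 1 / ((i : ℝ) + 1) ^ 2 ≤ 1 :=
      (div_le_one (by positivity)).mpr (one_le_pow₀ (by linarith [(i : ℕ).cast_nonneg (α := ℝ)]))
    have hw0 : 0 ≤ 1 / ((i : ℝ) + 1) ^ 2 := by positivity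
    -- As the weights are at most `1`, the error `δ = 1/k²` costs at most `1/k` over all copies.
    have h3 : 1 / ((i : ℝ) + 1) ^ 2 * Real.exp (-y i) - 1 / (k : ℝ) ^ 2
        ≤ 1 / ((i : ℝ) + 1) ^ 2 * ((1 - 1 / (r : ℝ)) ^ c i - 1 / (k : ℝ) ^ 2) := by
      have a1 := mul_le_mul_of_nonneg_left h2 hw0
      have a2 := mul_le_mul_of_nonneg_right hw1 (by positivity : 0 ≤ 1 / (k : ℝ) ^ 2)
      rw [mul_sub]
      linarith
    calc _ ≤ (k.factorial : ℝ) ^ 2 * Fintype.card E *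
          (1 / ((i : ℝ) + 1) ^ 2 * ((1 - 1 / (r : ℝ)) ^ c i - 1 / (k : ℝ) ^ 2)) := by gcongr
      _ = (k.factorial : ℝ) ^ 2 * (1 / ((i : ℝ) + 1) ^ 2) *
          (((1 - 1 / (r : ℝ)) ^ c i - 1 / (k : ℝ) ^ 2) * Fintype.card E) := by ring
      _ ≤ _ := by gcongr
  refine le_trans ?_ (Finset.sum_le_sum fun i _ => term i)
  rw [← Finset.mul_sum, Finset.sum_sub_distrib, Finset.sum_const, Finset.card_univ,
    Fintype.card_fin, nsmul_eq_mul]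
  have : (k : ℝ) * (1 / (k : ℝ) ^ 2) = 1 / k := by field_simp
  rw [this]
  gcongr

/-- Every schedule of the Feige–Lovász–Tetali instance is expensive. -/
theorem exists_le_cost_fltInstance : ∃ C : ℝ, 0 ≤ C ∧
    ∀ {V E : Type} [Fintype V] [Fintype E] [DecidableEq V] {r k : ℕ} {edge : E → Finset V}
      (_ : 2 ≤ r) (_ : 1 ≤ k) (h : IsHardHypergraph (2 * k) (1 / (k : ℝ) ^ 2) r edge)
      (σ : GMSSC.Schedule (Fin k × V)),
      (k.factorial : ℝ) ^ 2 * Fintype.card E * (2 * ((r : ℝ) - 1) * (2 * Real.log k - C))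
        ≤ (fltInstance k edge h.edge_nonempty).cost σ := by
  obtain ⟨C, hC0, hC⟩ := exists_log_sub_le_sum
  -- The extra `1` is the error `1/k` summed over `k` stages.
  refine ⟨C + 1, by linarith, fun {V E} _ _ _ {r k edge} hr hk h σ => ?_⟩
  have hr0 : (2 : ℝ) ≤ r := by exact_mod_cast hr
  have hk0 : (0 : ℝ) < k := by exact_mod_cast hk
  have hrc : ((2 * (r - 1) : ℕ) : ℝ) = 2 * ((r : ℝ) - 1) := by
    push_cast [Nat.cast_sub (by omega : 1 ≤ r)]; ring
  refine le_trans ?_ ((sum_range_le_sum_range_mul fun s hs t ht =>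
    le_sum_card_uncovered hr hs h σ ht).trans
      (sum_card_uncovered_le_cost h.edge_nonempty σ (2 * (r - 1) * k)))
  rw [← Finset.mul_sum, Finset.sum_sub_distrib, Finset.sum_const, Finset.card_range,
    nsmul_eq_mul, mul_one_div_cancel hk0.ne', hrc]
  have hCk := hC k hk
  rw [mul_left_comm (2 * ((r : ℝ) - 1))]
  have : 0 ≤ 2 * ((r : ℝ) - 1) := by linarith
  refine mul_le_mul_of_nonneg_left ?_ (by positivity)
  refine mul_le_mul_of_nonneg_left ?_ this
  linarith

/-! ### The sequential preemptive schedule and its cost -/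

theorem intervalIntegral_indicator_Ioc_const {a b t : ℝ} (c : ℝ) (ha : 0 ≤ a) (hb : t ≤ b)
    (ht : 0 ≤ t) :
    ∫ u in (0 : ℝ)..t, (Set.Ioc a b).indicator (fun _ => c) u = max (t - a) 0 * c := by
  rw [intervalIntegral.integral_of_le ht, integral_indicator measurableSet_Ioc,
    Measure.restrict_restrict measurableSet_Ioc, Set.Ioc_inter_Ioc, setIntegral_const,
    max_eq_left ha, min_eq_right hb, Real.volume_real_Ioc, smul_eq_mul]

theorem integrable_indicator_Ioc_const (a b c : ℝ) :
    Integrable ((Set.Ioc a b).indicator fun _ => c) :=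
  (integrable_indicator_iff measurableSet_Ioc).mpr (integrableOn_const measure_Ioc_lt_top.ne)

theorem setIntegral_Ioi_indicator_Ioc_const {a b : ℝ} (c : ℝ) (ha : 0 ≤ a) (hab : a ≤ b) :
    ∫ u in Set.Ioi (0 : ℝ), (Set.Ioc a b).indicator (fun _ => c) u = (b - a) * c := by
  rw [integral_indicator measurableSet_Ioc, Measure.restrict_restrict measurableSet_Ioc,
    Set.inter_eq_left.mpr ((Set.Ioc_subset_Ioi_self).trans (Set.Ioi_subset_Ioi ha)),
    setIntegral_const,
    Real.volume_real_Ioc_of_le hab, smul_eq_mul]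

theorem sum_indicator_Ioc_mul {r : ℝ} (hr : 0 ≤ r) (k : ℕ) (t : ℝ) :
    ∑ i ∈ Finset.range k, (Set.Ioc (i * r) (((i : ℝ) + 1) * r)).indicator (fun _ => (1 : ℝ)) t
      = (Set.Ioc 0 (k * r)).indicator (fun _ => (1 : ℝ)) t := by
  induction k with
  | zero => simp
  | succ k ih =>
    rw [Finset.sum_range_succ, ih]
    have h1 : (0 : ℝ) ≤ k * r := by positivity
    have h2 : (k : ℝ) * r ≤ ((k : ℝ) + 1) * r := by nlinarith
    push_cast
    rw [← Set.Ioc_union_Ioc_eq_Ioc h1 h2,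
      Set.indicator_union_of_disjoint (Set.Ioc_disjoint_Ioc_of_le le_rfl)]

/-- The copies one after another, each uniformly for `r` units of time, then all that is left,
uniformly. -/
noncomputable def sequentialSchedule (V : Type) [Fintype V] (k r : ℕ) (p : Fin k × V) (t : ℝ) : ℝ :=
  (Set.Ioc ((p.1 : ℝ) * r) (((p.1 : ℝ) + 1) * r)).indicator
      (fun _ => 1 / (Fintype.card V : ℝ)) t
    + (Set.Ioc ((k : ℝ) * r) (k * Fintype.card V)).indicator
      (fun _ => 1 / ((k : ℝ) * Fintype.card V)) t

/-- A vertex receives `r/|V|` in the phase of its copy and `k (|V| - r)/(k |V|)` in the final phase,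
in total `1`. -/
theorem isPreemptive_sequentialSchedule {V : Type} [Fintype V] {k r : ℕ} (hk : 1 ≤ k) (hr : 0 < r)
    (hrV : r ≤ Fintype.card V) : GMSSC.IsPreemptive (sequentialSchedule V k r) := by
  have hk0 : (0 : ℝ) < k := by exact_mod_cast hk
  have hr0 : (0 : ℝ) < r := by exact_mod_cast hr
  have hn : (r : ℝ) ≤ Fintype.card V := by exact_mod_cast hrV
  have hn0 : (0 : ℝ) < Fintype.card V := by linarith
  have hkn : (k : ℝ) * r ≤ k * Fintype.card V := by gcongr
  have ind1 : ∀ (s : Set ℝ) (c t : ℝ),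
      s.indicator (fun _ => c) t = c * s.indicator (fun _ => (1 : ℝ)) t := by
    intro s c t
    by_cases h : t ∈ s <;> simp [h]
  refine ⟨fun p t _ => ?_, fun p => ?_, fun t ht => ?_, fun p => ?_⟩
  · exact add_nonneg (Set.indicator_nonneg (fun _ _ => by positivity) t)
      (Set.indicator_nonneg (fun _ _ => by positivity) t)
  · exact ((integrable_indicator_Ioc_const _ _ _).add
      (integrable_indicator_Ioc_const _ _ _)).integrableOn
  · have hcard : ((Fintype.card (Fin k × V) : ℕ) : ℝ) = k * Fintype.card V := by simp
    rw [hcard] at ht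
    simp only [sequentialSchedule, Fintype.sum_prod_type, Finset.sum_const, Finset.card_univ,
      nsmul_eq_mul, Finset.sum_add_distrib]
    simp only [ind1 _ (1 / (Fintype.card V : ℝ)), ind1 _ (1 / ((k : ℝ) * Fintype.card V)),
      ← mul_assoc, mul_one_div_cancel hn0.ne', one_mul]
    rw [Fin.sum_univ_eq_sum_range
      (fun i => (Set.Ioc ((i : ℝ) * r) (((i : ℝ) + 1) * r)).indicator (fun _ => (1 : ℝ)) t),
      sum_indicator_Ioc_mul hr0.le, hcard, mul_one_div_cancel (by positivity), one_mul]
    have := Set.indicator_union_of_disjoint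
      (Set.Ioc_disjoint_Ioc_of_le (a := (0 : ℝ)) (d := k * Fintype.card V) (le_refl (k * r : ℝ)))
      (fun _ => (1 : ℝ))
    rw [Set.Ioc_union_Ioc_eq_Ioc (by positivity) hkn] at this
    have := congrFun this t
    rw [Set.indicator_of_mem ht] at this
    exact this.symm
  · have h1 : ((p.1 : ℕ) : ℝ) * r ≤ ((p.1 : ℝ) + 1) * r := by nlinarith
    simp only [sequentialSchedule]
    rw [integral_add (integrable_indicator_Ioc_const _ _ _).integrableOn
      (integrable_indicator_Ioc_const _ _ _).integrableOn,
      setIntegral_Ioi_indicator_Ioc_const _ (by positivity) h1,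
      setIntegral_Ioi_indicator_Ioc_const _ (by positivity) hkn]
    field_simp
    ring

theorem preemptiveCoverTime_sequentialSchedule {V E : Type} [Fintype V] [Fintype E]
    [DecidableEq V] {c₀ δ : ℝ} {k r : ℕ} {edge : E → Finset V}
    (h : IsHardHypergraph c₀ δ r edge)
    (p : Σ i : Fin k, E × Fin ((k.factorial) ^ 2 / ((i : ℕ) + 1) ^ 2)) :
    (fltInstance k edge h.edge_nonempty).preemptiveCoverTime (sequentialSchedule V k r) p
      = ((p.1 : ℝ) + 1) * r := by
  obtain ⟨i, e, j⟩ := p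
  have hr0 : (0 : ℝ) < r := by exact_mod_cast h.pos
  have hn : (r : ℝ) ≤ Fintype.card V := by exact_mod_cast h.le_card
  have hn0 : (0 : ℝ) < Fintype.card V := by linarith
  have hik : (i : ℝ) + 1 ≤ k := by exact_mod_cast i.2
  have hk0 : (0 : ℝ) < k := by have : (0 : ℝ) ≤ ((i : ℕ) : ℝ) := by positivity
                               linarith
  have hT : ((i : ℝ) + 1) * r ≤ k * r := by gcongr
  have hce : (r : ℝ) * (edge e).card = Fintype.card V := by exact_mod_cast h.uniform e
  -- In its phase the edge is served at rate `|e|/|V| = 1/r`; the final phase has not begun by then.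
  have key : ∀ t : ℝ, 0 ≤ t → t ≤ ((i : ℝ) + 1) * r →
      ∫ s in (0 : ℝ)..t, ∑ v ∈ (fltInstance k edge h.edge_nonempty).edge ⟨i, e, j⟩,
        sequentialSchedule V k r v s = max (t - i * r) 0 / r := by
    intro t ht0 ht
    have e1 : ∀ s, ∑ v ∈ (fltInstance k edge h.edge_nonempty).edge ⟨i, e, j⟩,
        sequentialSchedule V k r v s = (edge e).card *
          ((Set.Ioc ((i : ℝ) * r) (((i : ℝ) + 1) * r)).indicator
              (fun _ => 1 / (Fintype.card V : ℝ)) s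
            + (Set.Ioc ((k : ℝ) * r) (k * Fintype.card V)).indicator
              (fun _ => 1 / ((k : ℝ) * Fintype.card V)) s) := by
      intro s
      simp only [fltInstance, Finset.sum_product, Finset.sum_singleton, sequentialSchedule,
        Finset.sum_const, nsmul_eq_mul]
    simp only [e1]
    rw [intervalIntegral.integral_const_mul, intervalIntegral.integral_add
      (integrable_indicator_Ioc_const _ _ _).intervalIntegrable
      (integrable_indicator_Ioc_const _ _ _).intervalIntegrable,
      intervalIntegral_indicator_Ioc_const _ (by positivity) ht ht0,
      intervalIntegral_indicator_Ioc_const _ (by positivity) (ht.trans (hT.trans (by gcongr))) ht0,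
      max_eq_right (by linarith : t - k * r ≤ 0), ← hce]
    have : ((edge e).card : ℝ) ≠ 0 := fun h0 => by rw [h0] at hce; simp at hce; linarith
    field_simp
    ring
  have hreq : ((fltInstance k edge h.edge_nonempty).req ⟨i, e, j⟩ : ℝ) = 1 := by simp [fltInstance]
  refine IsLeast.csInf_eq ⟨⟨by positivity, ?_⟩, fun t ht => ?_⟩
  · rw [hreq, key _ (by positivity) le_rfl]
    have : ((i : ℝ) + 1) * r - i * r = r := by ring
    rw [this, max_eq_left hr0.le, div_self hr0.ne']
  · by_contra! hlt
    have h1 := ht.2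
    rw [hreq, key t ht.1 hlt.le, div_eq_one_iff_eq hr0.ne'] at h1
    have : max (t - i * r) 0 < r := max_lt (by linarith) hr0
    linarith

theorem preemptiveCost_sequentialSchedule {V E : Type} [Fintype V] [Fintype E]
    [DecidableEq V] {c₀ δ : ℝ} {k r : ℕ} {edge : E → Finset V}
    (h : IsHardHypergraph c₀ δ r edge) :
    (fltInstance k edge h.edge_nonempty).preemptiveCost (sequentialSchedule V k r)
      = Fintype.card E * (k.factorial : ℝ) ^ 2 * r *
        ∑ i ∈ Finset.range k, 1 / ((i : ℝ) + 1) := by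
  rw [GMSSC.preemptiveCost,
    Finset.sum_congr rfl fun p _ => preemptiveCoverTime_sequentialSchedule h p,
    Fintype.sum_sigma, ← Fin.sum_univ_eq_sum_range (fun i => 1 / ((i : ℝ) + 1)), Finset.mul_sum]
  refine Finset.sum_congr rfl fun i _ => ?_
  change ∑ _y : E × Fin (k.factorial ^ 2 / ((i : ℕ) + 1) ^ 2), ((i : ℝ) + 1) * r = _
  rw [Finset.sum_const, Finset.card_univ, Fintype.card_prod, Fintype.card_fin, nsmul_eq_mul,
    Nat.cast_mul, cast_factorial_sq_div]
  field_simp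

/-! ### The gap of 4 and its consequences -/

theorem fltInstance_gap {ε : ℝ} (hε : 0 < ε) : ∃ K : ℕ, ∀ k : ℕ, K ≤ k →
    ∃ c₀ δ : ℝ, 0 < c₀ ∧ 0 < δ ∧ ∃ R : ℕ, ∀ r : ℕ, R ≤ r →
      ∀ (V E : Type) [Fintype V] [Fintype E] [DecidableEq V] (edge : E → Finset V)
        (h : IsHardHypergraph c₀ δ r edge),
        (fltInstance k edge h.edge_nonempty).IsMSSC ∧
        (∃ x : Fin k × V → ℝ → ℝ, GMSSC.IsPreemptive x ∧
          |(fltInstance k edge h.edge_nonempty).preemptiveCost x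
              - Fintype.card E * (k.factorial : ℝ) ^ 2 * r * Real.log k|
            ≤ ε * (Fintype.card E * (k.factorial : ℝ) ^ 2 * r * Real.log k)) ∧
        (∀ σ : GMSSC.Schedule (Fin k × V),
          (4 - ε) * (Fintype.card E * (k.factorial : ℝ) ^ 2 * r * Real.log k)
            ≤ (fltInstance k edge h.edge_nonempty).cost σ) := by
  obtain ⟨C, hC0, hC⟩ := exists_le_cost_fltInstance
  have hlog : Filter.Tendsto (fun k : ℕ => Real.log k) Filter.atTop Filter.atTop :=
    Real.tendsto_log_atTop.comp tendsto_natCast_atTop_atTop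
  -- `1/ε` absorbs the difference between harmonic sum and logarithm, `4 C/ε` the additive constant
  -- of the lower bound.
  obtain ⟨K, hK⟩ := Filter.eventually_atTop.mp (hlog.eventually_ge_atTop (1 / ε + 4 * C / ε))
  refine ⟨max K 1, fun k hk => ?_⟩
  have hk1 : 1 ≤ k := (le_max_right _ _).trans hk
  have hk0 : (0 : ℝ) < k := by exact_mod_cast hk1
  have hlk := hK k ((le_max_left _ _).trans hk)
  have hl1 : 1 ≤ ε * Real.log k := by
    have : 1 / ε ≤ Real.log k := le_trans (by linarith [show 0 ≤ 4 * C / ε by positivity]) hlk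
    rwa [div_le_iff₀' hε] at this
  have hl2 : 4 * C ≤ ε * Real.log k := by
    have : 4 * C / ε ≤ Real.log k := le_trans (by linarith [show 0 ≤ 1 / ε by positivity]) hlk
    rwa [div_le_iff₀' hε] at this
  have hl0 : 0 ≤ Real.log k := Real.log_natCast_nonneg k
  -- `r ≥ 8/ε` pays for `r - 1` in place of `r`, with half of `ε`; the other half pays for `C`.
  refine ⟨2 * k, 1 / (k : ℝ) ^ 2, by positivity, by positivity, max 2 ⌈8 / ε⌉₊,
    fun r hr V E _ _ _ edge h => ⟨isMSSC_fltInstance h k, ?_, fun σ => ?_⟩⟩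
  · refine ⟨sequentialSchedule V k r, isPreemptive_sequentialSchedule hk1 h.pos h.le_card, ?_⟩
    rw [preemptiveCost_sequentialSchedule h, ← mul_sub, abs_mul, abs_of_nonneg (by positivity),
      mul_left_comm ε]
    refine mul_le_mul_of_nonneg_left (abs_le.mpr ⟨?_, ?_⟩) (by positivity)
    · have h1 := log_le_sum_range_one_div k
      have h2 : Real.log k ≤ Real.log ((k : ℝ) + 1) := Real.log_le_log hk0 (by linarith)
      linarith
    · have := sum_range_one_div_le k
      linarith
  · have hr2 : 2 ≤ r := (le_max_left _ _).trans hr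
    have hrR : (2 : ℝ) ≤ r := by exact_mod_cast hr2
    have hrε : 8 ≤ ε * r := by
      have : 8 / ε ≤ r := (Nat.le_ceil _).trans (by exact_mod_cast (le_max_right _ _).trans hr)
      rwa [div_le_iff₀' hε] at this
    refine le_trans ?_ (hC hr2 hk1 h σ)
    have e1 : (4 - ε) * (Fintype.card E * (k.factorial : ℝ) ^ 2 * r * Real.log k)
        = (k.factorial : ℝ) ^ 2 * Fintype.card E * ((4 - ε) * r * Real.log k) := by ring
    rw [e1]
    refine mul_le_mul_of_nonneg_left ?_ (by positivity)
    have a1 : 2 * ((r : ℝ) - 1) * C ≤ 2 * r * C := by nlinarith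
    have a2 : 2 * r * (4 * C) ≤ 2 * r * (ε * Real.log k) := by gcongr
    have a3 : 8 * Real.log k ≤ ε * r * Real.log k := by gcongr
    nlinarith

theorem IsMSSCRoundingFactor.four_le {ρ : ℝ} (hρ : IsMSSCRoundingFactor ρ) : 4 ≤ ρ := by
  have key : ∀ ε : ℝ, 0 < ε → ε < 1 → 4 - ε ≤ ρ * (1 + ε) := by
    intro ε hε hε1
    obtain ⟨K, hK⟩ := fltInstance_gap hε
    obtain ⟨c₀, δ, -, hδ, R, hR⟩ := hK (max K 2) (le_max_left _ _)
    set k := max K 2 with hk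
    have hk2 : (2 : ℝ) ≤ k := by exact_mod_cast le_max_right K 2
    obtain ⟨n, m, edge, -, h⟩ := exists_isHardHypergraph c₀ δ hδ (le_max_right R 2)
    obtain ⟨hM, ⟨x, hx, hxc⟩, hσ⟩ := hR (max R 2) (le_max_left _ _) _ _ edge h
    obtain ⟨σ, hs⟩ := hρ _ _ _ hM x hx
    have h1 := (hσ σ).trans hs
    have hE : (0 : ℝ) < Fintype.card (Fin m) := by
      have := h.edges_nonempty
      exact_mod_cast Fintype.card_pos
    have hr : (0 : ℝ) < ((max R 2 : ℕ) : ℝ) := by exact_mod_cast h.pos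
    have hl : 0 < Real.log k := Real.log_pos (by linarith)
    set L := (Fintype.card (Fin m) : ℝ) * (k.factorial : ℝ) ^ 2 * (max R 2 : ℕ) * Real.log k with hL
    have hL0 : 0 < L := by positivity
    have h2 := abs_le.mp hxc
    have hpc : 0 < (fltInstance k edge h.edge_nonempty).preemptiveCost x := by nlinarith
    -- The sign is needed to multiply the upper bound on the preemptive cost by `ρ`.
    have hρ0 : 0 ≤ ρ := by
      by_contra! hneg
      nlinarith [mul_pos_of_neg_of_neg hneg (neg_neg_of_pos hpc)]
    have h3 : ρ * (fltInstance k edge h.edge_nonempty).preemptiveCost x ≤ ρ * ((1 + ε) * L) := by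
      gcongr
      linarith
    have h4 : (4 - ε) * L ≤ (ρ * (1 + ε)) * L := by linarith
    exact le_of_mul_le_mul_right h4 hL0
  by_contra! hlt
  -- If `ρ < 4`, then `(ρ + 1) ε < 5 ε ≤ (4 - ρ)/2`, against `4 - ε ≤ ρ (1 + ε)`.
  have hε0 : 0 < min (1 / 2) ((4 - ρ) / 10) := lt_min (by norm_num) (by linarith)
  have h1 := key _ hε0 ((min_le_left _ _).trans_lt (by norm_num))
  have h2 := min_le_right (1 / 2) ((4 - ρ) / 10)
  nlinarith

theorem mainTheorem8 :
    -- the hypergraphs used in the construction exist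
    (∀ c₀ δ : ℝ, 0 < c₀ → 0 < δ → ∃ R : ℕ, ∀ r : ℕ, R ≤ r →
      ∃ (n m : ℕ) (edge : Fin m → Finset (Fin n)),
        Function.Injective edge ∧ IsHardHypergraph c₀ δ r edge) ∧
    -- on the resulting instances preemptive schedules cost about `m a r ln k`, and non-preemptive
    -- schedules at least about `4 m a r ln k`
    (∀ ε : ℝ, 0 < ε → ∃ K : ℕ, ∀ k : ℕ, K ≤ k →
      ∃ c₀ δ : ℝ, 0 < c₀ ∧ 0 < δ ∧ ∃ R : ℕ, ∀ r : ℕ, R ≤ r →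
        ∀ (V E : Type) [Fintype V] [Fintype E] [DecidableEq V] (edge : E → Finset V)
          (h : IsHardHypergraph c₀ δ r edge),
          (fltInstance k edge h.edge_nonempty).IsMSSC ∧
          (∃ x : Fin k × V → ℝ → ℝ, GMSSC.IsPreemptive x ∧
            |(fltInstance k edge h.edge_nonempty).preemptiveCost x
                - Fintype.card E * (k.factorial : ℝ) ^ 2 * r * Real.log k|
              ≤ ε * (Fintype.card E * (k.factorial : ℝ) ^ 2 * r * Real.log k)) ∧
          (∀ σ : GMSSC.Schedule (Fin k × V),
            (4 - ε) * (Fintype.card E * (k.factorial : ℝ) ^ 2 * r * Real.log k)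
              ≤ (fltInstance k edge h.edge_nonempty).cost σ)) ∧
    -- no rounding factor below `4` is possible, even for MSSC
    (∀ ρ : ℝ, IsMSSCRoundingFactor ρ → 4 ≤ ρ) ∧
    -- the conjecture is false
    ¬ ISVConjecture ∧
    -- the two-step approach cannot give a factor below `8`, even for MSSC
    (∀ α : ℝ, IsTwoStepGuarantee α → 8 ≤ α) := by
  refine ⟨fun c₀ δ _ hδ => ⟨2, fun r hr => exists_isHardHypergraph c₀ δ hδ hr⟩,
    fun ε hε => fltInstance_gap hε, fun ρ hρ => hρ.four_le, fun h => ?_, ?_⟩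
  · have h2 : IsMSSCRoundingFactor 2 := fun V E _ _ I _ x hx => h V E I x hx
    linarith [h2.four_le]
  · rintro α ⟨ρ, hρ, rfl⟩
    linarith [hρ.four_le]
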